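/- Let $k$ be a field of characteristic zero. For positive integers $n,i$ let $n=\binom{n_i}{i}+\binom{n_{i-1}}{i-1}+\cdots+\binom{n_j}{j}$ with $n_i>n_{i-1}>\cdots>n_j\ge j\ge 1$ be the (unique) $i$-binomial expansion $n_{(i)}$ of $n$, and put $$(n_{(i)})^{-1}_{-1}=\binom{n_i-1}{i-1}+\cdots+\binom{n_j-1}{j-1},\qquad (n_{(i)})^{+1}_{+1}=\binom{n_i+1}{i+1}+\cdots+\binom{n_j+1}{j+1},$$ where $\binom{m}{q}=0$ for $m<q$; put also $(0_{(i)})^{+1}_{+1}=0$. Let $H:\ h_0=1,h_1,\dots,h_e,0,0,\dots$ be a finite sequence of nonnegative integers which is allowed as a Hilbert function by Macaulay's theorem, i.e. $h_{i+1}\le ((h_i)_{(i)})^{+1}_{+1}$ for all $i\ge 1$, and let $t$ be the least integer $t\geq 0$ with $h_t\le t$. An artinian algebra is a quotient $A=k[x_1,\dots,x_r]/I$ of finite length, with $r\ge 0$ arbitrary, $\deg x_s=1$ for all $s$, and $I$ a homogeneous ideal; its Hilbert function is $i\mapsto\dim_k A_i$. It has the Weak Lefschetz Property if, for a generic linear form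 $L$ (i.e. for all $L$ in some nonempty Zariski open set of linear forms), all multiplication maps $\cdot L: A_i\to A_{i+1}$, $i\ge 0$, have maximal rank $\min(\dim_k A_i,\dim_k A_{i+1})$. Then all artinian algebras over $k$ with Hilbert function $H$ have the Weak Lefschetz Property if and only if $$h_{i-1}=((h_i)_{(i)})^{-1}_{-1}\qquad\text{for all } 1\le i\le t-1 .$$ -/

import Mathlib

attribute [local instance] MvPolynomial.gradedAlgebra

namespace WeakLefschetz

/-! ### Binomial expansions -/

/-- `IsBinomialExpansion n i j a`: the numbers `a i > a (i-1) > ⋯ > a j ≥ j ≥ 1` form the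
`i`-binomial expansion `n = C(a i, i) + C(a (i-1), i-1) + ⋯ + C(a j, j)` of `n`.
The values of `a` outside `[j, i]` play no role. -/
structure IsBinomialExpansion (n i j : ℕ) (a : ℕ → ℕ) : Prop where
  one_le : 1 ≤ j
  le : j ≤ i
  lt : ∀ l, j ≤ l → l < i → a l < a (l + 1)
  le_last : j ≤ a j
  sum_eq : n = ∑ l ∈ Finset.Icc j i, (a l).choose l

theorem IsBinomialExpansion.le_apply {n i j : ℕ} {a : ℕ → ℕ}
    (h : IsBinomialExpansion n i j a) {l : ℕ} (hj : j ≤ l) (hi : l ≤ i) : l ≤ a l := by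
  induction l, hj using Nat.le_induction with
  | base => exact h.le_last
  | succ l hjl ih =>
    have h1 := h.lt l hjl (by omega)
    have h2 := ih (by omega)
    omega

theorem IsBinomialExpansion.pos {n i j : ℕ} {a : ℕ → ℕ}
    (h : IsBinomialExpansion n i j a) : 1 ≤ n := by
  have h1 : (a i).choose i ≤ n := by
    rw [h.sum_eq]
    exact Finset.single_le_sum (f := fun l => (a l).choose l) (fun _ _ => Nat.zero_le _)
      (Finset.mem_Icc.2 ⟨h.le, le_rfl⟩)
  have h2 := Nat.choose_pos (h.le_apply h.le le_rfl)
  omega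

/-- The expansion without its leading term. -/
theorem IsBinomialExpansion.tail {n i j : ℕ} {a : ℕ → ℕ}
    (h : IsBinomialExpansion n (i + 1) j a) (hj : j ≤ i) :
    IsBinomialExpansion (n - (a (i + 1)).choose (i + 1)) i j a ∧
      (a (i + 1)).choose (i + 1) ≤ n := by
  have hs := h.sum_eq
  rw [Finset.sum_Icc_succ_top (by omega)] at hs
  refine ⟨⟨h.one_le, hj, fun l h1 h2 => h.lt l h1 (by omega), h.le_last, by omega⟩, by omega⟩

theorem IsBinomialExpansion.choose_le {n i j : ℕ} {a : ℕ → ℕ}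
    (h : IsBinomialExpansion n i j a) : (a i).choose i ≤ n := by
  rw [h.sum_eq]
  exact Finset.single_le_sum (f := fun l => (a l).choose l) (fun _ _ => Nat.zero_le _)
    (Finset.mem_Icc.2 ⟨h.le, le_rfl⟩)

theorem IsBinomialExpansion.lt_choose {n i j : ℕ} {a : ℕ → ℕ}
    (h : IsBinomialExpansion n i j a) : n < (a i + 1).choose i := by
  induction i generalizing n with
  | zero => have := h.one_le; have := h.le; omega
  | succ i ih =>
    rw [Nat.choose_succ_succ']
    rcases Nat.lt_or_ge i j with hji | hji
    · have hj : j = i + 1 := le_antisymm h.le hji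
      have hs := h.sum_eq
      rw [hj, Finset.Icc_self, Finset.sum_singleton] at hs
      have h1 := h.le_apply h.le le_rfl
      have h2 : 0 < (a (i + 1)).choose i := Nat.choose_pos (by omega)
      omega
    · obtain ⟨h1, h2⟩ := h.tail hji
      have h3 := ih h1
      have h4 : (a i + 1).choose i ≤ (a (i + 1)).choose i :=
        Nat.choose_le_choose i (h.lt i hji (by omega))
      omega

/-- Uniqueness of the binomial expansion. -/
theorem IsBinomialExpansion.unique {n i j j' : ℕ} {a a' : ℕ → ℕ}
    (h : IsBinomialExpansion n i j a) (h' : IsBinomialExpansion n i j' a') :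
    j = j' ∧ ∀ l, j ≤ l → l ≤ i → a l = a' l := by
  induction i generalizing n with
  | zero => have := h.one_le; have := h.le; omega
  | succ i ih =>
    have key : ∀ {b b' : ℕ}, b.choose (i + 1) ≤ n → n < (b' + 1).choose (i + 1) → b ≤ b' := by
      intro b b' h1 h2
      by_contra hlt
      have := Nat.choose_le_choose (i + 1) (show b' + 1 ≤ b by omega)
      omega
    have htop : a (i + 1) = a' (i + 1) :=
      le_antisymm (key h.choose_le h'.lt_choose) (key h'.choose_le h.lt_choose)
    have one : ∀ {m : ℕ} {b : ℕ → ℕ}, IsBinomialExpansion n (i + 1) m b → i < m →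
        m = i + 1 ∧ n = (b (i + 1)).choose (i + 1) := by
      intro m b hb hm
      have hm' : m = i + 1 := le_antisymm hb.le hm
      have hs := hb.sum_eq
      rw [hm', Finset.Icc_self, Finset.sum_singleton] at hs
      exact ⟨hm', hs⟩
    rcases Nat.lt_or_ge i j with hj | hj <;> rcases Nat.lt_or_ge i j' with hj' | hj'
    · obtain ⟨e1, -⟩ := one h hj
      obtain ⟨e2, -⟩ := one h' hj'
      refine ⟨by omega, fun l h1 h2 => ?_⟩
      obtain rfl : l = i + 1 := by omega
      exact htop
    · obtain ⟨-, e1⟩ := one h hj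
      have := (h'.tail hj').1.pos
      rw [htop] at e1
      omega
    · obtain ⟨-, e1⟩ := one h' hj'
      have := (h.tail hj).1.pos
      rw [← htop] at e1
      omega
    · have t1 := (h.tail hj).1
      have t2 := (h'.tail hj').1
      rw [← htop] at t2
      obtain ⟨e1, e2⟩ := ih t1 t2
      refine ⟨e1, fun l h1 h2 => ?_⟩
      rcases Nat.lt_or_ge i l with hl | hl
      · obtain rfl : l = i + 1 := by omega
        exact htop
      · exact e2 l h1 hl

/-- Existence of the binomial expansion, for positive `n` and `i`. -/
theorem exists_isBinomialExpansion {n i : ℕ} (hn : 1 ≤ n) (hi : 1 ≤ i) :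
    ∃ j a, IsBinomialExpansion n i j a := by
  induction i, hi using Nat.le_induction generalizing n with
  | base =>
    exact ⟨1, fun _ => n, le_rfl, le_rfl, fun l h1 h2 => by omega, hn, by simp⟩
  | succ i hi ih =>
    let P : ℕ → Prop := fun m => m.choose (i + 1) ≤ n
    have hb : ∀ m, P m → m ≤ n + i := by
      intro m hm
      by_contra hlt
      have h1 := Nat.choose_le_choose (i + 1) (show n + i + 1 ≤ m by omega)
      have h2 : n + 1 ≤ (n + i + 1).choose (i + 1) := by
        clear hm h1 hlt ih hn
        induction n with
        | zero => simp
        | succ n ihn =>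
          rw [show n + 1 + i + 1 = (n + i + 1) + 1 by ring, Nat.choose_succ_succ']
          have : 0 < (n + i + 1).choose i := Nat.choose_pos (by omega)
          omega
      have h3 : m.choose (i + 1) ≤ n := hm
      omega
    have h0 : P (i + 1) := by simpa [P] using hn
    set m := Nat.findGreatest P (n + i) with hm
    have hPm : P m := Nat.findGreatest_spec (hb _ h0) h0
    have him : i + 1 ≤ m := Nat.le_findGreatest (hb _ h0) h0
    have hlt : n < (m + 1).choose (i + 1) := by
      by_contra hle
      have h1 : P (m + 1) := not_lt.1 hle
      have := Nat.le_findGreatest (hb _ h1) h1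
      omega
    have hPm' : m.choose (i + 1) ≤ n := hPm
    rw [Nat.choose_succ_succ'] at hlt
    rcases Nat.eq_zero_or_pos (n - m.choose (i + 1)) with hr | hr
    · refine ⟨i + 1, fun _ => m, by omega, le_rfl, fun l h1 h2 => by omega, him, ?_⟩
      simp only [Finset.Icc_self, Finset.sum_singleton]
      omega
    · obtain ⟨j, a, h⟩ := ih hr
      have ha : a i < m := by
        by_contra hle
        have h1 := Nat.choose_le_choose i (not_lt.1 hle)
        have h2 := h.choose_le
        omega
      have hji := h.le
      refine ⟨j, fun l => if l = i + 1 then m else a l, h.one_le, by omega, ?_, ?_, ?_⟩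
      · intro l h1 h2
        rcases Nat.lt_or_ge l i with hl | hl
        · have := h.lt l h1 hl
          simpa [show l ≠ i + 1 by omega, show l ≠ i by omega] using this
        · obtain rfl : l = i := by omega
          simpa using ha
      · simpa [show j ≠ i + 1 by omega] using h.le_last
      · rw [Finset.sum_Icc_succ_top (by omega)]
        have : ∑ l ∈ Finset.Icc j i, (if l = i + 1 then m else a l).choose l
            = ∑ l ∈ Finset.Icc j i, (a l).choose l := by
          refine Finset.sum_congr rfl fun l hl => ?_
          have := (Finset.mem_Icc.1 hl).2
          rw [if_neg (by omega)]
        rw [this, ← h.sum_eq, if_pos rfl]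
        omega

open Classical in
/-- `(n_{(i)})^{-1}_{-1} = C(a i - 1, i - 1) + ⋯ + C(a j - 1, j - 1)`, where
`n = C(a i, i) + ⋯ + C(a j, j)` is the `i`-binomial expansion of `n`, for `n, i ≥ 1`
(and `0` if `n = 0` or `i = 0`). -/
noncomputable def lowerShift (n i : ℕ) : ℕ :=
  if h : ∃ p : ℕ × (ℕ → ℕ), IsBinomialExpansion n i p.1 p.2 then
    ∑ l ∈ Finset.Icc h.choose.1 i, (h.choose.2 l - 1).choose (l - 1)
  else 0

open Classical in
/-- `(n_{(i)})^{+1}_{+1} = C(a i + 1, i + 1) + ⋯ + C(a j + 1, j + 1)`, where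
`n = C(a i, i) + ⋯ + C(a j, j)` is the `i`-binomial expansion of `n`, for `n, i ≥ 1`
(and `0` if `n = 0` or `i = 0`); it is also written `n^{<i>}`. -/
noncomputable def upperShift (n i : ℕ) : ℕ :=
  if h : ∃ p : ℕ × (ℕ → ℕ), IsBinomialExpansion n i p.1 p.2 then
    ∑ l ∈ Finset.Icc h.choose.1 i, (h.choose.2 l + 1).choose (l + 1)
  else 0

theorem IsBinomialExpansion.lowerShift_eq {n i j : ℕ} {a : ℕ → ℕ}
    (h : IsBinomialExpansion n i j a) :
    lowerShift n i = ∑ l ∈ Finset.Icc j i, (a l - 1).choose (l - 1) := by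
  have hex : ∃ p : ℕ × (ℕ → ℕ), IsBinomialExpansion n i p.1 p.2 := ⟨(j, a), h⟩
  obtain ⟨e1, e2⟩ := h.unique hex.choose_spec
  rw [lowerShift, dif_pos hex, ← e1]
  refine Finset.sum_congr rfl fun l hl => ?_
  rw [e2 l (Finset.mem_Icc.1 hl).1 (Finset.mem_Icc.1 hl).2]

theorem IsBinomialExpansion.upperShift_eq {n i j : ℕ} {a : ℕ → ℕ}
    (h : IsBinomialExpansion n i j a) :
    upperShift n i = ∑ l ∈ Finset.Icc j i, (a l + 1).choose (l + 1) := by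
  have hex : ∃ p : ℕ × (ℕ → ℕ), IsBinomialExpansion n i p.1 p.2 := ⟨(j, a), h⟩
  obtain ⟨e1, e2⟩ := h.unique hex.choose_spec
  rw [upperShift, dif_pos hex, ← e1]
  refine Finset.sum_congr rfl fun l hl => ?_
  rw [e2 l (Finset.mem_Icc.1 hl).1 (Finset.mem_Icc.1 hl).2]

/-- The sequences allowed by Macaulay's theorem as Hilbert functions of standard graded algebras:
`h_0 = 1` and `h_{i+1} ≤ ((h_i)_{(i)})^{+1}_{+1}` for all `i ≥ 1`
(where the right-hand side is `0` if `h_i = 0`). -/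
structure IsOSequence (H : ℕ → ℕ) : Prop where
  zero : H 0 = 1
  growth : ∀ i, 1 ≤ i → H (i + 1) ≤ upperShift (H i) i

/-! ### Standard graded algebras `A = k[x_1, …, x_r] / I` -/

/-- The graded piece `A_i` of `A = k[x_1, …, x_r] / I`: the classes of the forms of degree `i`. -/
noncomputable def gradedPiece {k : Type*} [Field k] {r : ℕ} (I : Ideal (MvPolynomial (Fin r) k))
    (i : ℕ) : Submodule k (MvPolynomial (Fin r) k ⧸ I) :=
  (MvPolynomial.homogeneousSubmodule (Fin r) k i).map (Ideal.Quotient.mkₐ k I).toLinearMap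

/-- The Hilbert function `i ↦ dim_k A_i` of `A = k[x_1, …, x_r] / I`. -/
noncomputable def hilbertFunction {k : Type*} [Field k] {r : ℕ}
    (I : Ideal (MvPolynomial (Fin r) k)) (i : ℕ) : ℕ :=
  Module.finrank k (gradedPiece I i)

/-- The linear form `c_1 x_1 + ⋯ + c_r x_r`. -/
noncomputable def linearForm {k : Type*} [Field k] {r : ℕ} (c : Fin r → k) :
    MvPolynomial (Fin r) k :=
  ∑ s, MvPolynomial.C (c s) * MvPolynomial.X s

theorem linearForm_isHomogeneous {k : Type*} [Field k] {r : ℕ} (c : Fin r → k) :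
    (linearForm c).IsHomogeneous 1 :=
  MvPolynomial.IsHomogeneous.sum _ _ _ fun s _ => MvPolynomial.isHomogeneous_C_mul_X (c s) s

theorem linearForm_mul_mem {k : Type*} [Field k] {r : ℕ} (I : Ideal (MvPolynomial (Fin r) k))
    (c : Fin r → k) (i : ℕ) (x : MvPolynomial (Fin r) k ⧸ I) (hx : x ∈ gradedPiece I i) :
    LinearMap.mulLeft k (Ideal.Quotient.mk I (linearForm c)) x ∈ gradedPiece I (i + 1) := by
  obtain ⟨p, hp, rfl⟩ := hx
  refine ⟨linearForm c * p, ?_, ?_⟩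
  · have h := (linearForm_isHomogeneous c).mul hp
    rw [add_comm 1 i] at h
    exact h
  · exact map_mul (Ideal.Quotient.mk I) (linearForm c) p

/-- Multiplication `A_i → A_{i+1}` by the linear form with coefficients `c`. -/
noncomputable def mulLinearForm {k : Type*} [Field k] {r : ℕ} (I : Ideal (MvPolynomial (Fin r) k))
    (c : Fin r → k) (i : ℕ) : gradedPiece I i →ₗ[k] gradedPiece I (i + 1) :=
  (LinearMap.mulLeft k (Ideal.Quotient.mk I (linearForm c))).restrict (linearForm_mul_mem I c i)

/-- The Weak Lefschetz Property of `A = k[x_1, …, x_r] / I` (over an infinite field `k`): for a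
generic linear form `L`, i.e. for all `L` whose coefficients lie in some nonempty basic Zariski
open set `{F ≠ 0}`, every multiplication map `L : A_i → A_{i+1}` has the maximal possible rank
`min (dim A_i) (dim A_{i+1})`. -/
def HasWLP {k : Type*} [Field k] {r : ℕ} (I : Ideal (MvPolynomial (Fin r) k)) : Prop :=
  ∃ F : MvPolynomial (Fin r) k, F ≠ 0 ∧ ∀ c : Fin r → k, MvPolynomial.eval c F ≠ 0 →
    ∀ i : ℕ, Module.finrank k (LinearMap.range (mulLinearForm I c i)) =
      min (hilbertFunction I i) (hilbertFunction I (i + 1))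

end WeakLefschetz

namespace WeakLefschetz

/-! ### Numerical properties of the shifts -/

/-! Sufficiency rests on Green's hyperplane restriction theorem, read as a bound on ranks: for
generic `L` the map `A_{i-1} → A_i` has rank at least `lowerShift h_i i` (by Pascal's rule, `h_i`
minus Green's bound for `A/LA`). If `h_{i-1}` equals this number for all `1 ≤ i < t`, those maps are
injective. Since `h_t ≤ t`, all terms in the expansion of `h_t` are 1, so `lowerShift h_t t = h_t`
and the map into `A_t` is onto. It stays onto in higher degrees, because `A` is generated in degree
one.

For necessity, `lowerShift_le_iff` turns Macaulay's inequality into `lowerShift h_{i+1} (i+1) ≤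
h_i`. If this is strict for some `i ≥ 1` with `i + 1 < t`, the lexicographic algebra with Hilbert
function `H` fails in degree `i`. Its last standard monomial of degree `i` is killed by all linear
forms, so `L` is not injective. As `h_{i+1} > i + 1`, all monomials of degree `i + 1` in the two
smallest variables are standard, so `L` is not onto either.

Green's theorem (`exists_lowerShift_le_finrank_range`) follows by a double induction, on the degree
and on the codimension of a submodule `W`, comparing `W` with `W + hM` and `W : h`. The numerical
input is `lowerShift_le_of_add_le`. The lexicographic algebra is controlled by explicit ranks of
monomials: multiplication by the smallest variable changes the rank by `upperShift`. -/

theorem IsBinomialExpansion.of_tail {m i j a : ℕ} {b : ℕ → ℕ} (h : IsBinomialExpansion m i j b)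
    (hm : m < a.choose i) :
    IsBinomialExpansion (a.choose (i + 1) + m) (i + 1) j
      (fun l => if l = i + 1 then a else b l) := by
  have hji := h.le
  have ha : b i < a := by
    by_contra hle
    have h1 := Nat.choose_le_choose i (not_lt.1 hle)
    have h2 := h.choose_le
    omega
  refine ⟨h.one_le, by omega, ?_, ?_, ?_⟩
  · intro l h1 h2
    rcases Nat.lt_or_ge l i with hl | hl
    · simpa [show l ≠ i + 1 by omega, show l ≠ i by omega] using h.lt l h1 hl
    · obtain rfl : l = i := by omega
      simpa using ha
  · simpa [show j ≠ i + 1 by omega] using h.le_last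
  · rw [Finset.sum_Icc_succ_top (by omega)]
    have : ∑ l ∈ Finset.Icc j i, (if l = i + 1 then a else b l).choose l
        = ∑ l ∈ Finset.Icc j i, (b l).choose l := by
      refine Finset.sum_congr rfl fun l hl => ?_
      rw [if_neg (by have := (Finset.mem_Icc.1 hl).2; omega)]
    rw [this, ← h.sum_eq, if_pos rfl, add_comm]

theorem isBinomialExpansion_choose {a i : ℕ} (ha : i + 1 ≤ a) :
    IsBinomialExpansion (a.choose (i + 1)) (i + 1) (i + 1) (fun _ => a) :=
  ⟨by omega, le_rfl, fun l h1 h2 => by omega, ha, by simp⟩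

@[simp] theorem lowerShift_zero_left (i : ℕ) : lowerShift 0 i = 0 := by
  rw [lowerShift, dif_neg]
  rintro ⟨p, hp⟩
  exact absurd hp.pos (by omega)

@[simp] theorem upperShift_zero_left (i : ℕ) : upperShift 0 i = 0 := by
  rw [upperShift, dif_neg]
  rintro ⟨p, hp⟩
  exact absurd hp.pos (by omega)

@[simp] theorem lowerShift_zero_right (n : ℕ) : lowerShift n 0 = 0 := by
  rw [lowerShift, dif_neg]
  rintro ⟨p, hp⟩
  have := hp.one_le
  have := hp.le
  omega

/-- The leading term of the binomial expansion. -/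
theorem exists_eq_choose_add {n : ℕ} (i : ℕ) (hn : 1 ≤ n) :
    ∃ a m, i + 1 ≤ a ∧ m < a.choose i ∧ n = a.choose (i + 1) + m := by
  obtain ⟨j, a, h⟩ := exists_isBinomialExpansion hn (show 1 ≤ i + 1 by omega)
  have h1 := h.lt_choose
  have h2 := h.choose_le
  rw [Nat.choose_succ_succ'] at h1
  exact ⟨a (i + 1), n - (a (i + 1)).choose (i + 1), h.le_apply h.le le_rfl, by omega, by omega⟩

theorem lowerShift_choose {a i : ℕ} (ha : i + 1 ≤ a) :
    lowerShift (a.choose (i + 1)) (i + 1) = (a - 1).choose i := by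
  rw [(isBinomialExpansion_choose ha).lowerShift_eq]
  simp

theorem upperShift_choose {a i : ℕ} (ha : i + 1 ≤ a) :
    upperShift (a.choose (i + 1)) (i + 1) = (a + 1).choose (i + 2) := by
  rw [(isBinomialExpansion_choose ha).upperShift_eq]
  simp

theorem exists_expansion_of_lt_choose {m a i : ℕ} (hm : m < a.choose i) (h0 : 0 < m) :
    ∃ j b, IsBinomialExpansion m i j b := by
  refine exists_isBinomialExpansion h0 ?_
  rcases Nat.eq_zero_or_pos i with rfl | h
  · simp at hm; omega
  · exact h

theorem lowerShift_choose_add_of_lt {a i m : ℕ} (ha : i + 1 ≤ a) (hm : m < a.choose i) :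
    lowerShift (a.choose (i + 1) + m) (i + 1) = (a - 1).choose i + lowerShift m i := by
  rcases Nat.eq_zero_or_pos m with rfl | h0
  · simpa using lowerShift_choose ha
  · obtain ⟨j, b, h⟩ := exists_expansion_of_lt_choose hm h0
    have hji := h.le
    rw [h.lowerShift_eq, (h.of_tail hm).lowerShift_eq, Finset.sum_Icc_succ_top (by omega),
      add_comm]
    simp only [if_true, Nat.add_sub_cancel]
    congr 1
    refine Finset.sum_congr rfl fun l hl => ?_
    rw [if_neg (by have := (Finset.mem_Icc.1 hl).2; omega)]

theorem upperShift_choose_add {a i m : ℕ} (ha : i + 1 ≤ a) (hm : m < a.choose i) :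
    upperShift (a.choose (i + 1) + m) (i + 1) = (a + 1).choose (i + 2) + upperShift m i := by
  rcases Nat.eq_zero_or_pos m with rfl | h0
  · simpa using upperShift_choose ha
  · obtain ⟨j, b, h⟩ := exists_expansion_of_lt_choose hm h0
    have hji := h.le
    rw [h.upperShift_eq, (h.of_tail hm).upperShift_eq, Finset.sum_Icc_succ_top (by omega),
      add_comm]
    simp only [if_true]
    congr 1
    refine Finset.sum_congr rfl fun l hl => ?_
    rw [if_neg (by have := (Finset.mem_Icc.1 hl).2; omega)]

theorem lowerShift_one {n : ℕ} (hn : 1 ≤ n) : lowerShift n 1 = 1 := by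
  simpa using lowerShift_choose (i := 0) (a := n) (by omega)

/-- At the boundary `m = a.choose i` the expansion collapses to the single term `(a + 1).choose (i +
1)`, but Pascal's rule keeps the formula valid. This is what permits stepping from `n` to `n + 1`
below. -/
theorem lowerShift_choose_add {a i m : ℕ} (ha : i + 1 ≤ a) (hm : m ≤ a.choose i) :
    lowerShift (a.choose (i + 1) + m) (i + 1) = (a - 1).choose i + lowerShift m i := by
  rcases hm.lt_or_eq with h | rfl
  · exact lowerShift_choose_add_of_lt ha h
  · rw [add_comm, ← Nat.choose_succ_succ', lowerShift_choose (by omega)]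
    cases i with
    | zero => simp
    | succ i =>
      obtain ⟨a, rfl⟩ : ∃ b, a = b + 1 := ⟨a - 1, by omega⟩
      rw [lowerShift_choose (by omega)]
      simp [Nat.choose_succ_succ', add_comm]

theorem lowerShift_one_left (i : ℕ) : lowerShift 1 (i + 1) = 1 := by
  simpa using lowerShift_choose (i := i) (a := i + 1) le_rfl

/-- Unit steps make both `lowerShift n i` and the complementary `n - lowerShift n i` monotone in
`n`. -/
theorem lowerShift_succ (n i : ℕ) :
    lowerShift n i ≤ lowerShift (n + 1) i ∧ lowerShift (n + 1) i ≤ lowerShift n i + 1 := by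
  induction i generalizing n with
  | zero => simp
  | succ i ih =>
    rcases Nat.eq_zero_or_pos n with rfl | hn
    · simp [lowerShift_one_left]
    · obtain ⟨a, m, h1, h2, rfl⟩ := exists_eq_choose_add i hn
      rw [add_assoc, lowerShift_choose_add h1 h2.le, lowerShift_choose_add h1 h2]
      have := ih m
      rw [Nat.succ_eq_add_one]
      omega

theorem lowerShift_mono (i : ℕ) : Monotone fun n => lowerShift n i :=
  monotone_nat_of_le_succ fun n => (lowerShift_succ n i).1

theorem sub_lowerShift_mono (i : ℕ) : Monotone fun n => n - lowerShift n i :=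
  monotone_nat_of_le_succ fun n => by have := (lowerShift_succ n i).2; omega

theorem lowerShift_le (n i : ℕ) : lowerShift n i ≤ n := by
  induction n with
  | zero => simp
  | succ n ih => have := (lowerShift_succ n i).2; omega

/-- For `n ≤ i` the expansion is `C(i, i) + C(i-1, i-1) + ⋯`, with every term equal to 1. This is
where the bound `h_t ≤ t` enters. -/
theorem lowerShift_eq_self {n i : ℕ} (h : n ≤ i) : lowerShift n i = n := by
  induction i generalizing n with
  | zero => simp at h; simp [h]
  | succ i ih =>
    rcases Nat.eq_zero_or_pos n with rfl | hn
    · simp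
    · obtain ⟨n, rfl⟩ : ∃ m, n = m + 1 := ⟨n - 1, by omega⟩
      have := lowerShift_choose_add (a := i + 1) (i := i) (m := n) le_rfl (by simp; omega)
      simp only [Nat.choose_self, Nat.add_sub_cancel] at this
      rw [add_comm, this, ih (by omega)]

theorem lowerShift_choose_sub_one {a i : ℕ} (ha : i + 2 ≤ a) :
    lowerShift (a.choose (i + 1) - 1) (i + 1) = (a - 1).choose i := by
  induction i generalizing a with
  | zero => simpa using lowerShift_one (n := a - 1) (by omega)
  | succ i ih =>
    obtain ⟨a, rfl⟩ : ∃ b, a = b + 1 := ⟨a - 1, by omega⟩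
    have hpos : 0 < a.choose (i + 1) := Nat.choose_pos (by omega)
    have : (a + 1).choose (i + 1 + 1) - 1 = a.choose (i + 1 + 1) + (a.choose (i + 1) - 1) := by
      rw [Nat.choose_succ_succ']; omega
    rw [this, lowerShift_choose_add (by omega) (by omega), ih (by omega)]
    obtain ⟨a, rfl⟩ : ∃ b, a = b + 1 := ⟨a - 1, by omega⟩
    simp [Nat.choose_succ_succ', add_comm]

theorem sub_lowerShift_lt_choose {a i m : ℕ} (ha : i + 1 ≤ a) (hm : m < a.choose i) :
    m - lowerShift m i < (a - 1).choose i := by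
  cases i with
  | zero => simp at hm; simp [hm]
  | succ i =>
    have h1 := sub_lowerShift_mono (i + 1) (show m ≤ a.choose (i + 1) - 1 by omega)
    simp only at h1
    rw [lowerShift_choose_sub_one (by omega)] at h1
    obtain ⟨a, rfl⟩ : ∃ b, a = b + 1 := ⟨a - 1, by omega⟩
    have hpos : 0 < a.choose (i + 1) := Nat.choose_pos (by omega)
    rw [Nat.choose_succ_succ'] at h1
    simp only [Nat.add_sub_cancel] at h1 ⊢
    omega

/-- This is the extreme case `ρ = lowerShift h (i + 1) - 1` of the numerical step in Green's
theorem. After splitting off the leading binomial of `h`, Pascal's rule cancels the leading terms of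
both sides and leaves the same inequality for the remainder, one degree lower. -/
theorem sub_lowerShift_lt_lowerShift_sub (h i : ℕ) (hh : 1 ≤ h) :
    lowerShift h (i + 1) - 1 - lowerShift (lowerShift h (i + 1) - 1) i <
      lowerShift (h - lowerShift h (i + 1) + 1) (i + 1) := by
  induction i generalizing h with
  | zero =>
    rw [zero_add, lowerShift_one hh, lowerShift_one (by omega)]
    simp
  | succ i ih =>
    obtain ⟨a, m, h1, h2, rfl⟩ := exists_eq_choose_add (i + 1) hh
    rcases h1.eq_or_lt with rfl | h1'
    · simp only [Nat.choose_self, Nat.choose_succ_self_right] at h2 ⊢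
      rw [lowerShift_eq_self (n := 1 + m) (by omega),
        lowerShift_eq_self (n := 1 + m - 1) (by omega)]
      simp [lowerShift_one_left]
    · obtain ⟨a, rfl⟩ : ∃ b, a = b + 2 := ⟨a - 2, by omega⟩
      have hlt := sub_lowerShift_lt_choose (by omega) h2
      have hle := lowerShift_le m (i + 1)
      rw [lowerShift_choose_add h1 h2.le]
      simp only [show a + 2 - 1 = a + 1 by omega] at hlt ⊢
      have e1 : (a + 2).choose (i + 1 + 1) + m - ((a + 1).choose (i + 1) + lowerShift m (i + 1)) + 1
          = (a + 1).choose (i + 1 + 1) + (m - lowerShift m (i + 1) + 1) := by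
        rw [Nat.choose_succ_succ' (a + 1) (i + 1)]; omega
      rw [e1, lowerShift_choose_add (by omega) (by omega)]
      simp only [Nat.add_sub_cancel]
      have hp : (a + 1).choose (i + 1) = a.choose i + a.choose (i + 1) :=
        Nat.choose_succ_succ' _ _
      -- A zero remainder cannot use the induction hypothesis: there the subtraction of 1 must
      -- borrow from the leading binomial.
      rcases Nat.eq_zero_or_pos m with rfl | hm
      · have h3 := sub_lowerShift_mono (i + 1)
          (show (a + 1).choose (i + 1) - 1 ≤ (a + 1).choose (i + 1) by omega)
        simp only at h3
        rw [lowerShift_choose (a := a + 1) (by omega)] at h3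
        simp only [Nat.add_sub_cancel] at h3
        simp only [lowerShift_zero_left, lowerShift_one_left, add_zero, zero_add, Nat.sub_zero]
        omega
      · have h3 := ih m hm
        have hs1 : 1 ≤ lowerShift m (i + 1) := by
          have := lowerShift_mono (i + 1) hm
          simp only [lowerShift_one_left, Nat.succ_eq_add_one, zero_add] at this
          exact this
        have hs2 := lowerShift_mono (i + 1) h2.le
        simp only at hs2
        rw [lowerShift_choose (by omega)] at hs2
        simp only [show a + 2 - 1 = a + 1 by omega] at hs2
        have hs3 := lowerShift_choose_add (a := a + 1) (i := i) (m := lowerShift m (i + 1) - 1)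
          (by omega) (by omega)
        have e2 : (a + 1).choose (i + 1) + lowerShift m (i + 1) - 1
          = (a + 1).choose (i + 1) + (lowerShift m (i + 1) - 1) := by omega
        simp only [Nat.add_sub_cancel] at hs3
        rw [e2, hs3]
        omega

/-- The numerical step in the proof of Green's hyperplane restriction theorem. -/
theorem lowerShift_le_of_add_le {h i ρ : ℕ}
    (hle : lowerShift (h - ρ) (i + 1) + lowerShift ρ i ≤ ρ) : lowerShift h (i + 1) ≤ ρ := by
  by_contra hlt
  rw [not_le] at hlt
  have hh : 1 ≤ h := by have := lowerShift_le h (i + 1); omega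
  have h1 := sub_lowerShift_lt_lowerShift_sub h i hh
  -- Both sides are monotone in `ρ`, in opposite directions, so any smaller `ρ` contradicts the
  -- hypothesis as well.
  have h2 := sub_lowerShift_mono i (show ρ ≤ lowerShift h (i + 1) - 1 by omega)
  have h3 := lowerShift_le h (i + 1)
  have h4 := lowerShift_mono (i + 1) (show h - lowerShift h (i + 1) + 1 ≤ h - ρ by omega)
  simp only at h2 h4
  omega

/-! ### The two shifts as an adjoint pair -/

theorem upperShift_lt_choose {m a i : ℕ} (hm : m < a.choose i) :
    upperShift m i < (a + 1).choose (i + 1) := by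
  induction i generalizing m a with
  | zero => simp at hm; simp [hm]
  | succ i ih =>
    have hpos : i + 1 ≤ a := by
      by_contra h
      rw [Nat.choose_eq_zero_of_lt (by omega)] at hm
      omega
    rcases Nat.eq_zero_or_pos m with rfl | h0
    · simpa using Nat.choose_pos (by omega)
    · obtain ⟨b, m, h1, h2, rfl⟩ := exists_eq_choose_add i h0
      rw [upperShift_choose_add h1 h2]
      have hb : b < a := by
        by_contra h
        have := Nat.choose_le_choose (i + 1) (not_lt.1 h)
        omega
      have h3 := ih h2
      have h4 := Nat.choose_le_choose (i + 2) (show b + 2 ≤ a + 1 by omega)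
      have h5 : (b + 2).choose (i + 2) = (b + 1).choose (i + 1) + (b + 1).choose (i + 2) :=
        Nat.choose_succ_succ' _ _
      change _ < (a + 1).choose (i + 2)
      omega

/-- Together the two values say that `upperShift n i` is the largest number whose lower shift is at
most `n`. The alternative `n = 0` serves the induction, where a remainder in degree 0 is necessarily
zero. -/
theorem lowerShift_upperShift_and_succ {n i : ℕ} (h : 1 ≤ i ∨ n = 0) :
    lowerShift (upperShift n i) (i + 1) = n ∧ lowerShift (upperShift n i + 1) (i + 1) = n + 1 := by
  induction i generalizing n with
  | zero =>
    obtain rfl : n = 0 := by omega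
    simp [lowerShift_one_left]
  | succ i ih =>
    rcases Nat.eq_zero_or_pos n with rfl | h0
    · simp [lowerShift_one_left]
    · obtain ⟨a, m, h1, h2, rfl⟩ := exists_eq_choose_add i h0
      have h3 := upperShift_lt_choose h2
      have h4 : 1 ≤ i ∨ m = 0 := by
        rcases Nat.eq_zero_or_pos i with rfl | h
        · right; simpa using h2
        · exact Or.inl h
      obtain ⟨h5, h6⟩ := ih h4
      rw [upperShift_choose_add h1 h2, add_assoc ((a + 1).choose (i + 2)),
        lowerShift_choose_add (i := i + 1) (by omega) h3.le,
        lowerShift_choose_add (i := i + 1) (by omega) h3, h5, h6]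
      simp [add_assoc]

theorem lowerShift_le_iff {n m i : ℕ} (hi : 1 ≤ i) :
    lowerShift n (i + 1) ≤ m ↔ n ≤ upperShift m i := by
  obtain ⟨h1, h2⟩ := lowerShift_upperShift_and_succ (n := m) (Or.inl hi)
  constructor
  · intro h
    by_contra hlt
    have := lowerShift_mono (i + 1) (show upperShift m i + 1 ≤ n by omega)
    simp only at this
    omega
  · intro h
    have := lowerShift_mono (i + 1) h
    simp only at this
    omega

theorem upperShift_mono {i : ℕ} (hi : 1 ≤ i) : Monotone fun n => upperShift n i := by
  intro n m h
  simp only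
  rw [← lowerShift_le_iff hi, (lowerShift_upperShift_and_succ (Or.inl hi)).1]
  exact h

/-! ### Green's hyperplane restriction theorem -/

section Green

variable {k : Type*} [Field k] {r : ℕ}

/-- The rank of a linear family of linear maps is lower semicontinuous. -/
theorem exists_eval_ne_zero_finrank_le {V W : Type*} [AddCommGroup V] [Module k V]
    [FiniteDimensional k V] [AddCommGroup W] [Module k W] [FiniteDimensional k W]
    (φ : (Fin r → k) →ₗ[k] V →ₗ[k] W) (c₀ : Fin r → k) :
    ∃ F : MvPolynomial (Fin r) k, MvPolynomial.eval c₀ F ≠ 0 ∧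
      ∀ c, MvPolynomial.eval c F ≠ 0 →
        Module.finrank k (LinearMap.range (φ c₀)) ≤ Module.finrank k (LinearMap.range (φ c)) := by
  set n := Module.finrank k (LinearMap.range (φ c₀)) with hn
  let e : LinearMap.range (φ c₀) ≃ₗ[k] (Fin n → k) :=
    (Module.finBasis k (LinearMap.range (φ c₀))).equivFun
  obtain ⟨g, hg⟩ := LinearMap.exists_rightInverse_of_surjective (φ c₀).rangeRestrict
    (LinearMap.range_rangeRestrict _)
  obtain ⟨π, hπ⟩ := LinearMap.exists_leftInverse_of_injective (LinearMap.range (φ c₀)).subtype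
    (Submodule.ker_subtype _)
  -- A fixed section `g` and retraction `π` for the range of `φ c₀` compress `φ c` to a square
  -- matrix, linear in `c`. Its determinant is a polynomial in `c` with value 1 at `c₀`.
  let ψ : (Fin r → k) → (Fin n → k) →ₗ[k] (Fin n → k) :=
    fun c => (e.toLinearMap ∘ₗ π) ∘ₗ φ c ∘ₗ (g ∘ₗ e.symm.toLinearMap)
  let A : Matrix (Fin n) (Fin n) (MvPolynomial (Fin r) k) := fun i j =>
    ∑ s, MvPolynomial.C (LinearMap.toMatrix' (ψ (Pi.single s 1)) i j) * MvPolynomial.X s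
  have hA : ∀ c, MvPolynomial.eval c A.det = (LinearMap.toMatrix' (ψ c)).det := by
    intro c
    rw [RingHom.map_det]
    congr 1
    ext i j
    have hc : φ c = ∑ s, c s • φ (Pi.single s 1) := by
      conv_lhs => rw [pi_eq_sum_univ' c]
      simp [map_sum]
    change MvPolynomial.eval c (∑ s, _) = _
    simp [ψ, hc, LinearMap.toMatrix'_apply, map_sum, mul_comm]
  refine ⟨A.det, ?_, fun c hc => ?_⟩
  · rw [hA]
    have : ψ c₀ = LinearMap.id := by
      ext1 i
      ext1
      have h1 := LinearMap.congr_fun hg (e.symm (Pi.single i 1))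
      have h2 := LinearMap.congr_fun hπ (e.symm (Pi.single i 1))
      have h3 := congrArg Subtype.val h1
      simp only [LinearMap.coe_comp, Function.comp_apply, LinearMap.id_coe, id_eq,
        LinearMap.codRestrict_apply, LinearMap.rangeRestrict, Submodule.coe_subtype] at h2 h3
      simp [ψ, h3, h2]
    rw [this, LinearMap.toMatrix'_id, Matrix.det_one]
    exact one_ne_zero
  · rw [hA] at hc
    have hu : Function.Surjective (ψ c) := by
      have h1 : IsUnit (LinearMap.det (ψ c)) := by
        rw [← LinearMap.det_toMatrix']
        exact hc.isUnit
      exact (LinearEquiv.ofIsUnitDet (f := ψ c) (v := Pi.basisFun k (Fin n))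
        (v' := Pi.basisFun k (Fin n)) (by
          rw [LinearMap.det_toMatrix]; exact h1)).surjective
    have h1 : Module.finrank k (LinearMap.range (ψ c)) = n := by
      rw [LinearMap.range_eq_top.2 hu, finrank_top, Module.finrank_fin_fun]
    rw [← h1]
    calc Module.finrank k (LinearMap.range (ψ c))
        ≤ Module.finrank k (LinearMap.range (φ c ∘ₗ (g ∘ₗ e.symm.toLinearMap))) := by
          rw [LinearMap.range_comp]
          exact Submodule.finrank_map_le _ _
      _ ≤ _ := Submodule.finrank_mono (LinearMap.range_comp_le_range _ _)

theorem exists_eval_ne_zero [Infinite k] {F : MvPolynomial (Fin r) k} (hF : F ≠ 0) :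
    ∃ c, MvPolynomial.eval c F ≠ 0 := by
  by_contra! h
  exact hF (MvPolynomial.funext fun c => by simpa using h c)

theorem finrank_range_mkQ_comp {V W : Type*} [AddCommGroup V] [Module k V]
    [AddCommGroup W] [Module k W] [FiniteDimensional k W] (U : Submodule k W) (f : V →ₗ[k] W) :
    Module.finrank k (LinearMap.range (U.mkQ ∘ₗ f)) + Module.finrank k U =
      Module.finrank k (U ⊔ LinearMap.range f : Submodule k W) := by
  have h1 := LinearMap.finrank_range_add_finrank_ker
    (U.mkQ.domRestrict (U ⊔ LinearMap.range f))
  rw [← h1, LinearMap.range_domRestrict, LinearMap.ker_domRestrict, Submodule.ker_mkQ,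
    Submodule.map_sup, ← LinearMap.range_comp]
  have h2 : Submodule.map U.mkQ U = ⊥ := by simp
  rw [h2, bot_sup_eq]
  congr 1
  · exact (LinearEquiv.finrank_eq (Submodule.comapSubtypeEquivOfLe le_sup_left)).symm

variable {M : ℕ → Type*} [∀ d, AddCommGroup (M d)] [∀ d, Module k (M d)]
  [∀ d, FiniteDimensional k (M d)] (μ : ∀ d, (Fin r → k) →ₗ[k] M d →ₗ[k] M (d + 1))

/-- Comparison of the ranks of multiplication by `g` modulo `W`, modulo `W + h M` and modulo
the residual `W : h`. -/
theorem finrank_range_restrict_add_le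
    (hcomm : ∀ d c c' x, μ (d + 1) c (μ d c' x) = μ (d + 1) c' (μ d c x)) (d : ℕ)
    (W : Submodule k (M (d + 2))) (h g : Fin r → k) :
    Module.finrank k (LinearMap.range ((W ⊔ LinearMap.range (μ (d + 1) h)).mkQ ∘ₗ μ (d + 1) g)) +
      Module.finrank k (LinearMap.range ((W.comap (μ (d + 1) h)).mkQ ∘ₗ μ d g)) ≤
    Module.finrank k (LinearMap.range (W.mkQ ∘ₗ μ (d + 1) g)) := by
  have h1 := finrank_range_mkQ_comp (W ⊔ LinearMap.range (μ (d + 1) h)) (μ (d + 1) g)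
  have h2 := finrank_range_mkQ_comp W (μ (d + 1) g)
  have h3 := Submodule.finrank_sup_add_finrank_inf_eq (W ⊔ LinearMap.range (μ (d + 1) h))
    (W ⊔ LinearMap.range (μ (d + 1) g))
  have h4 := finrank_range_mkQ_comp W (μ (d + 1) h ∘ₗ μ d g)
  have h5 : Module.finrank k (LinearMap.range (W.mkQ ∘ₗ μ (d + 1) h ∘ₗ μ d g)) =
      Module.finrank k (LinearMap.range ((W.comap (μ (d + 1) h)).mkQ ∘ₗ μ d g)) := by
    have e1 := LinearMap.finrank_range_add_finrank_ker (W.mkQ ∘ₗ μ (d + 1) h ∘ₗ μ d g)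
    have e2 := LinearMap.finrank_range_add_finrank_ker ((W.comap (μ (d + 1) h)).mkQ ∘ₗ μ d g)
    have e3 : LinearMap.ker (W.mkQ ∘ₗ μ (d + 1) h ∘ₗ μ d g) =
        LinearMap.ker ((W.comap (μ (d + 1) h)).mkQ ∘ₗ μ d g) := by
      ext x
      simp
    rw [e3] at e1
    omega
  -- By commutativity `W + hgM` lies in `(W + hM) ∩ (W + gM)`; the rest is the dimension formula for
  -- a sum and an intersection.
  have h6 : W ⊔ LinearMap.range (μ (d + 1) h ∘ₗ μ d g) ≤
      (W ⊔ LinearMap.range (μ (d + 1) h)) ⊓ (W ⊔ LinearMap.range (μ (d + 1) g)) := by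
    refine le_inf (sup_le_sup_left (LinearMap.range_comp_le_range _ _) _)
      (sup_le_sup_left ?_ _)
    rintro _ ⟨x, rfl⟩
    exact ⟨μ d h x, by simp [hcomm d h g]⟩
  have h7 := Submodule.finrank_mono h6
  have h8 : (W ⊔ LinearMap.range (μ (d + 1) h)) ⊔ LinearMap.range (μ (d + 1) g) =
      (W ⊔ LinearMap.range (μ (d + 1) h)) ⊔ (W ⊔ LinearMap.range (μ (d + 1) g)) := by
    rw [← sup_sup_distrib_left, sup_assoc]
  rw [h8] at h1
  omega

theorem finrank_range_mkQ_comp_anti {V W : Type*} [AddCommGroup V] [Module k V]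
    [AddCommGroup W] [Module k W] [FiniteDimensional k W] {U U' : Submodule k W} (h : U ≤ U')
    (f : V →ₗ[k] W) :
    Module.finrank k (LinearMap.range (U'.mkQ ∘ₗ f)) ≤
      Module.finrank k (LinearMap.range (U.mkQ ∘ₗ f)) := by
  have : U'.mkQ ∘ₗ f = Submodule.factor h ∘ₗ U.mkQ ∘ₗ f := by
    ext x
    simp
  rw [this, LinearMap.range_comp]
  exact Submodule.finrank_map_le _ _

theorem finrank_quotient_comap {V W : Type*} [AddCommGroup V] [Module k V]
    [AddCommGroup W] [Module k W] (U : Submodule k W) (f : V →ₗ[k] W) :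
    Module.finrank k (V ⧸ U.comap f) = Module.finrank k (LinearMap.range (U.mkQ ∘ₗ f)) := by
  have h : U.comap f = LinearMap.ker (U.mkQ ∘ₗ f) := by
    ext x
    simp
  rw [h]
  exact (LinearMap.quotKerEquivRange _).finrank_eq

/-- The inductive step of Green's theorem, from `W` to the larger submodule `W + h M`. -/
theorem exists_lowerShift_le_finrank_range_of_step [Infinite k]
    (hspan : ∀ d, ⨆ c, LinearMap.range (μ d c) = ⊤) (d : ℕ)
    (hstep : ∀ (W : Submodule k (M (d + 1))) (h : Fin r → k),
      ∃ F : MvPolynomial (Fin r) k, F ≠ 0 ∧ ∀ g, MvPolynomial.eval g F ≠ 0 →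
        Module.finrank k (LinearMap.range ((W ⊔ LinearMap.range (μ d h)).mkQ ∘ₗ μ d g)) +
          lowerShift (Module.finrank k (LinearMap.range (W.mkQ ∘ₗ μ d h))) d ≤
        Module.finrank k (LinearMap.range (W.mkQ ∘ₗ μ d g)))
    (W : Submodule k (M (d + 1))) :
    ∃ F : MvPolynomial (Fin r) k, F ≠ 0 ∧ ∀ c, MvPolynomial.eval c F ≠ 0 →
      lowerShift (Module.finrank k (M (d + 1) ⧸ W)) (d + 1) ≤
        Module.finrank k (LinearMap.range (W.mkQ ∘ₗ μ d c)) := by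
  induction hn : Module.finrank k (M (d + 1) ⧸ W) using Nat.strong_induction_on generalizing W with
  | _ n ih =>
  rcases Nat.eq_zero_or_pos n with rfl | hn0
  · exact ⟨1, one_ne_zero, by simp⟩
  let rk : (Fin r → k) → ℕ := fun c => Module.finrank k (LinearMap.range (W.mkQ ∘ₗ μ d c))
  have hbdd : ∀ c, rk c ≤ n := fun c => hn ▸ Submodule.finrank_le _
  -- A form of maximal rank `ρ`. It is nonzero on the quotient unless `W` is everything, so `W + hM`
  -- has smaller codimension `n - ρ`.
  obtain ⟨h, hmax⟩ : ∃ h, ∀ c, rk c ≤ rk h := by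
    obtain ⟨_, ⟨⟨h, rfl⟩, hh⟩⟩ := (Set.Finite.subset (Set.finite_Iic n)
      (Set.range_subset_iff.2 hbdd)).exists_maximal (Set.range_nonempty rk)
    exact ⟨h, fun c => by
      by_contra hlt
      exact hlt (hh ⟨c, rfl⟩ (not_le.1 hlt).le)⟩
  have hpos : 0 < rk h := by
    by_contra h0
    have h1 : ∀ c, LinearMap.range (μ d c) ≤ W := by
      intro c
      have h2 : rk c = 0 := by have := hmax c; omega
      have h3 : LinearMap.range (W.mkQ ∘ₗ μ d c) = ⊥ := Submodule.finrank_eq_zero.1 h2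
      rw [LinearMap.range_eq_bot] at h3
      rintro _ ⟨x, rfl⟩
      simpa using LinearMap.congr_fun h3 x
    have h2 : W = ⊤ := top_le_iff.1 (hspan d ▸ iSup_le h1)
    subst h2
    have : Module.finrank k (M (d + 1) ⧸ (⊤ : Submodule k (M (d + 1)))) = 0 :=
      Module.finrank_zero_of_subsingleton
    omega
  have hcod : Module.finrank k (M (d + 1) ⧸ (W ⊔ LinearMap.range (μ d h))) = n - rk h := by
    have h1 := finrank_range_mkQ_comp W (μ d h)
    have h2 := W.finrank_quotient_add_finrank
    have h3 := (W ⊔ LinearMap.range (μ d h)).finrank_quotient_add_finrank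
    simp only [rk]
    omega
  obtain ⟨F₂, hF₂, h₂⟩ := ih (n - rk h) (by omega) _ hcod
  obtain ⟨F₁, hF₁, h₁⟩ := hstep W h
  obtain ⟨F, hF, h₀⟩ := exists_eval_ne_zero_finrank_le ((μ d).compr₂ W.mkQ) h
  have hF0 : F ≠ 0 := by
    rintro rfl
    simp at hF
  -- One `g` in both open sets gives `lowerShift (n - ρ) (d + 1) + lowerShift ρ d ≤ rk g ≤ ρ`, the
  -- hypothesis of the numerical step.
  obtain ⟨g, hg⟩ := exists_eval_ne_zero (mul_ne_zero hF₁ hF₂)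
  simp only [map_mul, mul_ne_zero_iff] at hg
  have h3 := h₁ g hg.1
  have h4 := h₂ g hg.2
  have h5 := hmax g
  have h6 : lowerShift n (d + 1) ≤ rk h := by
    apply lowerShift_le_of_add_le
    simp only [rk] at h4 h5 ⊢
    omega
  exact ⟨F, hF0, fun c hc => h6.trans (h₀ c hc)⟩

/-- **Green's hyperplane restriction theorem**, as a lower bound for the rank of multiplication
by a generic linear form into the degree `d + 1` part of a quotient of a graded module. -/
theorem exists_lowerShift_le_finrank_range [Infinite k]
    (hcomm : ∀ d c c' x, μ (d + 1) c (μ d c' x) = μ (d + 1) c' (μ d c x))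
    (hspan : ∀ d, ⨆ c, LinearMap.range (μ d c) = ⊤) (d : ℕ) (W : Submodule k (M (d + 1))) :
    ∃ F : MvPolynomial (Fin r) k, F ≠ 0 ∧ ∀ c, MvPolynomial.eval c F ≠ 0 →
      lowerShift (Module.finrank k (M (d + 1) ⧸ W)) (d + 1) ≤
        Module.finrank k (LinearMap.range (W.mkQ ∘ₗ μ d c)) := by
  induction d with
  | zero =>
    refine exists_lowerShift_le_finrank_range_of_step μ hspan 0 (fun W h => ?_) W
    -- Here `lowerShift _ 0 = 0`, so only monotonicity in the submodule is needed.
    exact ⟨1, one_ne_zero, fun g _ => by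
      simpa using finrank_range_mkQ_comp_anti le_sup_left (μ 0 g)⟩
  | succ d ih =>
    refine exists_lowerShift_le_finrank_range_of_step μ hspan (d + 1) (fun W h => ?_) W
    -- The residual `W : h` has codimension equal to the rank of `h` modulo `W`, so the bound one
    -- degree lower has the required form.
    obtain ⟨F, hF, h1⟩ := ih (W.comap (μ (d + 1) h))
    refine ⟨F, hF, fun g hg => ?_⟩
    have h2 := h1 g hg
    have h3 := finrank_range_restrict_add_le μ hcomm d W h g
    rw [finrank_quotient_comap] at h2
    exact (Nat.add_le_add_left h2 _).trans h3

end Green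

/-! ### The sufficient condition -/

section Sufficient

variable {k : Type*} [Field k] {r : ℕ} (I : Ideal (MvPolynomial (Fin r) k))

instance gradedPiece.instFiniteDimensional (i : ℕ) : FiniteDimensional k (gradedPiece I i) := by
  have : Module.Finite k (MvPolynomial.homogeneousSubmodule (Fin r) k i) :=
    Module.Finite.iff_fg.2 (MvPolynomial.homogeneousSubmodule_fg (Fin r) k i)
  exact inferInstanceAs (Module.Finite k
    ((MvPolynomial.homogeneousSubmodule (Fin r) k i).map (Ideal.Quotient.mkₐ k I).toLinearMap))

theorem mulLinearForm_apply (c : Fin r → k) (i : ℕ) (x : gradedPiece I i) :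
    (mulLinearForm I c i x : MvPolynomial (Fin r) k ⧸ I) =
      Ideal.Quotient.mk I (linearForm c) * x := rfl

/-- Multiplication by linear forms, linearly in the form. -/
noncomputable def mulForms (i : ℕ) :
    (Fin r → k) →ₗ[k] gradedPiece I i →ₗ[k] gradedPiece I (i + 1) where
  toFun c := mulLinearForm I c i
  map_add' c c' := by
    ext x
    simp [mulLinearForm_apply, linearForm, add_mul, Finset.sum_add_distrib]
  map_smul' a c := by
    ext x
    simp only [mulLinearForm_apply, linearForm, Pi.smul_apply, smul_eq_mul, map_mul, mul_assoc,
      ← Finset.mul_sum, RingHom.id_apply, LinearMap.smul_apply, Submodule.coe_smul_of_tower]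
    exact (Algebra.smul_def (A := MvPolynomial (Fin r) k ⧸ I) a _).symm

theorem linearForm_single (s : Fin r) :
    linearForm (Pi.single s 1 : Fin r → k) = MvPolynomial.X s := by
  simp [linearForm, Pi.single_apply, apply_ite MvPolynomial.C, ite_mul]

theorem iSup_range_mulForms (i : ℕ) : ⨆ c, LinearMap.range (mulForms I i c) = ⊤ := by
  rw [eq_top_iff]
  rintro ⟨_, p, hp, rfl⟩ -
  suffices h : Ideal.Quotient.mk I p ∈
      (⨆ c, LinearMap.range (mulForms I i c)).map (gradedPiece I (i + 1)).subtype by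
    obtain ⟨y, hy, hyp⟩ := h
    have hy' : y = ⟨_, p, hp, rfl⟩ := Subtype.ext hyp
    exact hy' ▸ hy
  rw [p.as_sum, map_sum]
  refine Submodule.sum_mem _ fun d hd => ?_
  have hdeg : d.degree = i + 1 := by
    by_contra hne
    exact MvPolynomial.mem_support_iff.1 hd (MvPolynomial.IsHomogeneous.coeff_eq_zero hp hne)
  obtain ⟨s, hs⟩ : ∃ s, d s ≠ 0 := by
    by_contra! h0
    have : d = 0 := Finsupp.ext h0
    simp [this] at hdeg
  have hsd : Finsupp.single s 1 + (d - Finsupp.single s 1) = d :=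
    add_tsub_cancel_of_le (Finsupp.single_le_iff.2 (Nat.one_le_iff_ne_zero.2 hs))
  have hdeg' : (d - Finsupp.single s 1).degree = i := by
    have := congrArg Finsupp.degree hsd
    rw [map_add, Finsupp.degree_single] at this
    omega
  let x : gradedPiece I i := ⟨Ideal.Quotient.mk I (MvPolynomial.monomial
    (d - Finsupp.single s 1) (p.coeff d)), _, MvPolynomial.isHomogeneous_monomial _ hdeg', rfl⟩
  refine ⟨mulForms I i (Pi.single s 1) x, Submodule.mem_iSup_of_mem (Pi.single s 1) ⟨x, rfl⟩, ?_⟩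
  change Ideal.Quotient.mk I (linearForm (Pi.single s 1)) * Ideal.Quotient.mk I _ = _
  rw [linearForm_single, ← map_mul, MvPolynomial.X, MvPolynomial.monomial_mul, one_mul, hsd]

theorem mulForms_comm (i : ℕ) (c c' : Fin r → k) (x : gradedPiece I i) :
    mulForms I (i + 1) c (mulForms I i c' x) = mulForms I (i + 1) c' (mulForms I i c x) := by
  ext
  exact mul_left_comm (Ideal.Quotient.mk I (linearForm c)) (Ideal.Quotient.mk I (linearForm c')) _

theorem exists_lowerShift_le_finrank_range_mulLinearForm [Infinite k] (i : ℕ) :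
    ∃ F : MvPolynomial (Fin r) k, F ≠ 0 ∧ ∀ c, MvPolynomial.eval c F ≠ 0 →
      lowerShift (hilbertFunction I (i + 1)) (i + 1) ≤
        Module.finrank k (LinearMap.range (mulLinearForm I c i)) := by
  obtain ⟨F, hF, h⟩ := exists_lowerShift_le_finrank_range (mulForms I) (mulForms_comm I)
    (iSup_range_mulForms I) i ⊥
  refine ⟨F, hF, fun c hc => ?_⟩
  have h1 := h c hc
  rw [(Submodule.quotEquivOfEqBot _ rfl).finrank_eq] at h1
  have h2 := finrank_range_mkQ_comp (⊥ : Submodule k (gradedPiece I (i + 1))) (mulForms I i c)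
  rw [bot_sup_eq, finrank_bot, add_zero] at h2
  rw [h2] at h1
  exact h1

/-- With `A_{i+1} = L A_i`, one gets `A_{i+2} = A_1 A_{i+1} = L A_1 A_i ⊆ L A_{i+1}`. -/
theorem mulLinearForm_surjective_succ {c : Fin r → k} {i : ℕ}
    (h : Function.Surjective (mulLinearForm I c i)) :
    Function.Surjective (mulLinearForm I c (i + 1)) := by
  rw [← LinearMap.range_eq_top, eq_top_iff, ← iSup_range_mulForms I (i + 1), iSup_le_iff]
  rintro c' _ ⟨x, rfl⟩
  obtain ⟨y, rfl⟩ := h x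
  exact ⟨mulForms I i c' y, mulForms_comm I i c c' y⟩

theorem finrank_range_mulLinearForm_of_surjective {c : Fin r → k} {i : ℕ}
    (h : Function.Surjective (mulLinearForm I c i)) :
    Module.finrank k (LinearMap.range (mulLinearForm I c i)) =
      min (hilbertFunction I i) (hilbertFunction I (i + 1)) := by
  have h1 := LinearMap.finrank_range_le (mulLinearForm I c i)
  rw [LinearMap.range_eq_top.2 h, finrank_top] at h1 ⊢
  exact (min_eq_right h1).symm

theorem hasWLP_of_eq_lowerShift [Infinite k] {t : ℕ} (ht : hilbertFunction I t ≤ t) (ht0 : 1 ≤ t)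
    (h : ∀ i, 1 ≤ i → i < t → hilbertFunction I (i - 1) = lowerShift (hilbertFunction I i) i) :
    HasWLP I := by
  obtain ⟨t, rfl⟩ : ∃ s, t = s + 1 := ⟨t - 1, by omega⟩
  choose F hF hrk using exists_lowerShift_le_finrank_range_mulLinearForm I
  refine ⟨∏ i ∈ Finset.range (t + 1), F i, Finset.prod_ne_zero_iff.2 fun i _ => hF i, fun c hc => ?_⟩
  rw [map_prod, Finset.prod_ne_zero_iff] at hc
  have hsurj : ∀ i, t ≤ i → Function.Surjective (mulLinearForm I c i) := by
    intro i hi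
    induction i, hi using Nat.le_induction with
    | base =>
      have h1 := hrk t c (hc t (Finset.mem_range.2 (by omega)))
      rw [lowerShift_eq_self ht] at h1
      rw [← LinearMap.range_eq_top]
      exact Submodule.eq_top_of_finrank_eq (le_antisymm (Submodule.finrank_le _) h1)
    | succ i _ ih => exact mulLinearForm_surjective_succ I ih
  intro i
  rcases Nat.lt_or_ge i t with hi | hi
  · have h1 := hrk i c (hc i (Finset.mem_range.2 (by omega)))
    have h2 := h (i + 1) (by omega) (by omega)
    have h3 := LinearMap.finrank_range_le (mulLinearForm I c i)
    have h4 := Submodule.finrank_le (LinearMap.range (mulLinearForm I c i))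
    rw [Nat.add_sub_cancel] at h2
    simp only [hilbertFunction] at h1 h2 ⊢
    omega
  · exact finrank_range_mulLinearForm_of_surjective I (hsurj i hi)

end Sufficient

/-! ### The lexicographic rank -/

/-- The rank of the monomial `y_{p_d} ⋯ y_{p_1}`, `p_d ≥ ⋯ ≥ p_1`, among the monomials of degree
`d` in lexicographic order, starting with the smallest monomial `y_0 ^ d`. -/
def lexRank : List ℕ → ℕ
  | [] => 0
  | p :: l => (p + l.length).choose (l.length + 1) + lexRank l

/-- The bound is the number of monomials of degree `l.length` in `y_0, …, y_{q-1}`. These occupy an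
initial segment of the order; `exists_lexRank_eq` shows that every rank in it is attained. -/
theorem lexRank_lt {q : ℕ} {l : List ℕ} (hl : l.Pairwise (· ≥ ·)) (hq : ∀ x ∈ l, x < q) :
    lexRank l < (q + l.length - 1).choose l.length := by
  induction l generalizing q with
  | nil => simp [lexRank]
  | cons p l ih =>
    rw [List.pairwise_cons] at hl
    have h1 := ih hl.2 (q := p + 1) fun x hx => Nat.lt_succ_of_le (hl.1 x hx)
    have h2 : p < q := hq p (by simp)
    have h3 := Nat.choose_le_choose (l.length + 1)
      (show p + l.length + 1 ≤ q + (l.length + 1) - 1 by omega)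
    rw [Nat.choose_succ_succ'] at h3
    rw [show p + 1 + l.length - 1 = p + l.length by omega] at h1
    simp only [lexRank, List.length_cons]
    omega

theorem lexRank_inj {l l' : List ℕ} (hl : l.Pairwise (· ≥ ·)) (hl' : l'.Pairwise (· ≥ ·))
    (hlen : l.length = l'.length) (h : lexRank l = lexRank l') : l = l' := by
  induction l generalizing l' with
  | nil => exact (List.length_eq_zero_iff.1 hlen.symm).symm
  | cons p l ih =>
    obtain ⟨p', l', rfl⟩ := List.exists_cons_of_length_eq_add_one hlen.symm
    rw [List.pairwise_cons] at hl hl'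
    simp only [List.length_cons, Nat.add_right_cancel_iff] at hlen
    have key : ∀ {p p' : ℕ} {l l' : List ℕ}, (∀ x ∈ l', x ≤ p') → l'.Pairwise (· ≥ ·) →
        l.length = l'.length → lexRank (p :: l) = lexRank (p' :: l') → p ≤ p' := by
      intro p p' l l' h1 h2 h3 h4
      by_contra hlt
      have h5 := lexRank_lt h2 (q := p' + 1) fun x hx => Nat.lt_succ_of_le (h1 x hx)
      have h6 := Nat.choose_le_choose (l'.length + 1)
        (show p' + l'.length + 1 ≤ p + l'.length by omega)
      rw [Nat.choose_succ_succ'] at h6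
      rw [show p' + 1 + l'.length - 1 = p' + l'.length by omega] at h5
      simp only [lexRank, h3] at h4
      omega
    obtain rfl : p = p' := le_antisymm (key hl'.1 hl'.2 hlen h) (key hl.1 hl.2 hlen.symm h.symm)
    simp only [lexRank, hlen, Nat.add_left_cancel_iff] at h
    rw [ih hl.2 hl'.2 hlen h]

theorem exists_lexRank_eq {n d q : ℕ} (h : n < (q + d - 1).choose d) :
    ∃ l : List ℕ, l.Pairwise (· ≥ ·) ∧ l.length = d ∧ (∀ x ∈ l, x < q) ∧ lexRank l = n := by
  induction d generalizing n q with
  | zero =>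
    simp at h
    exact ⟨[], by simp [lexRank, h]⟩
  | succ d ih =>
    rcases Nat.eq_zero_or_pos n with rfl | hn
    · have hq : 0 < q := by
        by_contra h0
        rw [Nat.choose_eq_zero_of_lt (by omega)] at h
        omega
      obtain ⟨l, h1, h2, h3, h4⟩ := ih (n := 0) (q := 1) (by simp)
      refine ⟨0 :: l, List.pairwise_cons.2 ⟨fun x hx => ?_, h1⟩, by simp [h2], ?_, ?_⟩
      · have := h3 x hx; omega
      · intro x hx
        rcases List.mem_cons.1 hx with rfl | hx
        · exact hq
        · have := h3 x hx; omega
      · simp [lexRank, h4]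
    · obtain ⟨a, m, h1, h2, rfl⟩ := exists_eq_choose_add d hn
      obtain ⟨l, h3, h4, h5, h6⟩ := ih (n := m) (q := a - d + 1)
        (by rwa [show a - d + 1 + d - 1 = a by omega])
      have ha : a < q + (d + 1) - 1 := by
        by_contra hle
        have := Nat.choose_le_choose (d + 1) (not_lt.1 hle)
        omega
      refine ⟨(a - d) :: l, List.pairwise_cons.2 ⟨fun x hx => ?_, h3⟩, by simp [h4], ?_, ?_⟩
      · have := h5 x hx; omega
      · intro x hx
        rcases List.mem_cons.1 hx with rfl | hx
        · omega
        · have := h5 x hx; omega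
      · simp [lexRank, h4, h6, show a - d + d = a by omega]

theorem lexRank_eq_zero {l : List ℕ} (h : ∀ x ∈ l, x = 0) : lexRank l = 0 := by
  induction l with
  | nil => rfl
  | cons p l ih =>
    simp only [List.mem_cons, forall_eq_or_imp] at h
    simp [lexRank, h.1, ih h.2]

/-- The nonzero terms of the rank form a binomial expansion, since the tops `p + l.length` decrease
strictly. Appending 0 raises every top and bottom by one, and zero entries contribute nothing. -/
theorem upperShift_lexRank {l : List ℕ} (hl : l.Pairwise (· ≥ ·)) :
    upperShift (lexRank l) l.length = lexRank (l ++ [0]) := by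
  induction l with
  | nil => simp [lexRank]
  | cons p l ih =>
    rw [List.pairwise_cons] at hl
    rcases Nat.eq_zero_or_pos p with rfl | hp
    · have h0 : ∀ x ∈ 0 :: l, x = 0 := by
        intro x hx
        rcases List.mem_cons.1 hx with rfl | hx
        · rfl
        · exact Nat.le_zero.1 (hl.1 x hx)
      rw [lexRank_eq_zero h0, lexRank_eq_zero, upperShift_zero_left]
      intro x hx
      rcases List.mem_append.1 hx with hx | hx
      · exact h0 x hx
      · simpa using hx
    · have h1 := lexRank_lt hl.2 (q := p + 1) fun x hx => Nat.lt_succ_of_le (hl.1 x hx)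
      rw [show p + 1 + l.length - 1 = p + l.length by omega] at h1
      simp only [lexRank, List.length_cons, List.cons_append, List.length_append, List.length_nil,
        zero_add]
      rw [upperShift_choose_add (by omega) h1, ih hl.2]
      rfl

/-- Entry by entry, `l ++ [0]` is dominated by the decreasing list `p :: l`, and each binomial is
monotone in its entry. -/
theorem lexRank_append_le_cons {p : ℕ} {l : List ℕ} (hl : (p :: l).Pairwise (· ≥ ·)) :
    lexRank (l ++ [0]) ≤ lexRank (p :: l) := by
  induction l generalizing p with
  | nil => simp [lexRank]
  | cons q l ih =>
    rw [List.pairwise_cons] at hl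
    have h1 := ih hl.2
    have h2 := hl.1 q (by simp)
    simp only [List.cons_append, lexRank, List.length_append, List.length_cons, List.length_nil,
      zero_add] at h1 ⊢
    have h3 := Nat.choose_le_choose (l.length + 1 + 1)
      (show q + (l.length + 1) ≤ p + (l.length + 1) by omega)
    omega

theorem lexRank_append_le_orderedInsert {p : ℕ} {l : List ℕ} (hl : l.Pairwise (· ≥ ·)) :
    lexRank (l ++ [0]) ≤ lexRank (l.orderedInsert (· ≥ ·) p) := by
  induction l with
  | nil => simp [lexRank]
  | cons q l ih =>
    by_cases h : p ≥ q
    · rw [List.orderedInsert_cons, if_pos h]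
      exact lexRank_append_le_cons (List.pairwise_cons.2 ⟨fun x hx => by
        rcases List.mem_cons.1 hx with rfl | hx
        · exact h
        · exact ((List.pairwise_cons.1 hl).1 x hx).trans h, hl⟩)
    · rw [List.orderedInsert_cons, if_neg h]
      have h1 := ih (List.pairwise_cons.1 hl).2
      simp only [List.cons_append, lexRank, List.length_append, List.length_cons, List.length_nil,
        zero_add, List.orderedInsert_length]
      omega

/-- The lexicographic rank of a monomial among the monomials of the same degree. -/
noncomputable def monomialRank {r : ℕ} (m : Fin r →₀ ℕ) : ℕ :=
  lexRank ((m.toMultiset.map Fin.val).sort (· ≥ ·))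

/-! ### Ranks of monomials in `r` variables -/

variable {r : ℕ}

theorem length_sort_toMultiset (m : Fin r →₀ ℕ) :
    ((m.toMultiset.map Fin.val).sort (· ≥ ·)).length = m.degree := by
  rw [Multiset.length_sort, Multiset.card_map, Finsupp.card_toMultiset]
  rfl

theorem monomialRank_lt {m : Fin r →₀ ℕ} {q : ℕ} (h : ∀ s ∈ m.support, (s : ℕ) < q) :
    monomialRank m < (q + m.degree - 1).choose m.degree := by
  have := lexRank_lt (q := q) (Multiset.pairwise_sort (m.toMultiset.map Fin.val) (· ≥ ·)) (by
    intro x hx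
    rw [Multiset.mem_sort, Multiset.mem_map] at hx
    obtain ⟨s, hs, rfl⟩ := hx
    exact h s (Finsupp.mem_toMultiset _ _ |>.1 hs))
  rwa [length_sort_toMultiset] at this

theorem monomialRank_inj {m m' : Fin r →₀ ℕ} (hd : m.degree = m'.degree)
    (h : monomialRank m = monomialRank m') : m = m' := by
  have := lexRank_inj (Multiset.pairwise_sort _ _) (Multiset.pairwise_sort _ _)
    (by rw [length_sort_toMultiset, length_sort_toMultiset, hd]) h
  have h1 := congrArg (fun l : List ℕ => (l : Multiset ℕ)) this
  simp only [Multiset.sort_eq] at h1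
  exact Multiset.toFinsupp.symm.injective (Multiset.map_injective Fin.val_injective h1)

theorem exists_monomialRank_eq {n d : ℕ} (h : n < (r + d - 1).choose d) :
    ∃ m : Fin r →₀ ℕ, m.degree = d ∧ monomialRank m = n := by
  obtain ⟨l, h1, h2, h3, h4⟩ := exists_lexRank_eq h
  have h5 : ∃ s : Multiset (Fin r), s.map Fin.val = l :=
    ⟨(l.pmap Fin.mk h3 : List (Fin r)), by simp [List.map_pmap]⟩
  obtain ⟨s, hs⟩ := h5
  have h6 : ((Multiset.toFinsupp s).toMultiset.map Fin.val).sort (· ≥ ·) = l := by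
    rw [Multiset.toFinsupp_toMultiset, hs, Multiset.coe_sort]
    exact List.mergeSort_of_pairwise (by simpa using h1)
  refine ⟨Multiset.toFinsupp s, ?_, ?_⟩
  · rw [← length_sort_toMultiset, h6, h2]
  · rw [monomialRank, h6, h4]

/-- Among all products of `m` with a variable, the one with `y_0` has the least rank, and that rank
is exactly the upper shift. Combined with Macaulay's inequality, this makes the set of nonstandard
monomials closed under multiplication. -/
theorem upperShift_monomialRank_le (m : Fin r →₀ ℕ) (s : Fin r) :
    upperShift (monomialRank m) m.degree ≤ monomialRank (m + Finsupp.single s 1) := by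
  have h1 := Multiset.pairwise_sort (m.toMultiset.map Fin.val) (· ≥ ·)
  have h2 := upperShift_lexRank h1
  have h3 := lexRank_append_le_orderedInsert (p := s) h1
  rw [length_sort_toMultiset] at h2
  have h4 : (((m + Finsupp.single s 1).toMultiset.map Fin.val).sort (· ≥ ·) : List ℕ) =
      ((m.toMultiset.map Fin.val).sort (· ≥ ·)).orderedInsert (· ≥ ·) (s : ℕ) := by
    refine List.Perm.eq_of_pairwise' (Multiset.pairwise_sort _ _)
      (List.Pairwise.orderedInsert _ _ h1) ?_
    rw [← Multiset.coe_eq_coe, Multiset.sort_eq]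
    have := List.perm_orderedInsert (· ≥ ·) (s : ℕ) ((m.toMultiset.map Fin.val).sort (· ≥ ·))
    rw [Multiset.coe_eq_coe.2 this, ← Multiset.cons_coe, Multiset.sort_eq]
    simp [Finsupp.toMultiset_single, add_comm]
  simp only [monomialRank]
  rw [h2, h4]
  exact h3

/-! ### The lexicographic ideal -/

section LexIdeal

variable (k : Type*) [Field k] (r : ℕ) (H : ℕ → ℕ)

/-- The ideal spanned by the monomials which are not among the `H d` lexicographically smallest
monomials of their degree `d`. -/
noncomputable def lexIdeal : Ideal (MvPolynomial (Fin r) k) :=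
  Ideal.span ((fun m => MvPolynomial.monomial m (1 : k)) ''
    {m : Fin r →₀ ℕ | H m.degree ≤ monomialRank m})

variable {k r H}

theorem lexIdeal_isHomogeneous :
    (lexIdeal k r H).IsHomogeneous (MvPolynomial.homogeneousSubmodule (Fin r) k) := by
  refine Ideal.homogeneous_span _ _ ?_
  rintro _ ⟨m, -, rfl⟩
  exact ⟨m.degree, MvPolynomial.isHomogeneous_monomial _ rfl⟩

theorem exists_sub_single {m : Fin r →₀ ℕ} {d : ℕ} (h : m.degree = d + 1) :
    ∃ (s : Fin r) (m' : Fin r →₀ ℕ), m = m' + Finsupp.single s 1 ∧ m'.degree = d := by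
  obtain ⟨s, hs⟩ : ∃ s, m s ≠ 0 := by
    by_contra! h0
    have : m = 0 := Finsupp.ext h0
    simp [this] at h
  have hsd : m - Finsupp.single s 1 + Finsupp.single s 1 = m :=
    tsub_add_cancel_of_le (Finsupp.single_le_iff.2 (Nat.one_le_iff_ne_zero.2 hs))
  refine ⟨s, m - Finsupp.single s 1, hsd.symm, ?_⟩
  have := congrArg Finsupp.degree hsd
  rw [map_add, Finsupp.degree_single] at this
  omega

theorem IsOSequence.le_monomialRank_add_single (hH : IsOSequence H) {m : Fin r →₀ ℕ}
    (h : H m.degree ≤ monomialRank m) (s : Fin r) :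
    H (m.degree + 1) ≤ monomialRank (m + Finsupp.single s 1) := by
  rcases Nat.eq_zero_or_pos m.degree with h0 | h0
  · obtain rfl := (Finsupp.degree_eq_zero_iff m).1 h0
    simp [hH.zero, monomialRank, lexRank] at h
  · exact ((hH.growth _ h0).trans (upperShift_mono h0 h)).trans (upperShift_monomialRank_le m s)

theorem IsOSequence.le_monomialRank_mono (hH : IsOSequence H) {m m' : Fin r →₀ ℕ}
    (h : H m.degree ≤ monomialRank m) (hm : m ≤ m') : H m'.degree ≤ monomialRank m' := by
  obtain ⟨n, rfl⟩ := exists_add_of_le hm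
  induction hd : n.degree generalizing n with
  | zero =>
    obtain rfl := (Finsupp.degree_eq_zero_iff n).1 hd
    simpa using h
  | succ d ih =>
    obtain ⟨s, n, rfl, hn⟩ := exists_sub_single hd
    have := hH.le_monomialRank_add_single (ih n le_self_add hn) s
    rw [← add_assoc, map_add, Finsupp.degree_single]
    exact this

theorem IsOSequence.mem_lexIdeal_iff (hH : IsOSequence H) {p : MvPolynomial (Fin r) k} :
    p ∈ lexIdeal k r H ↔ ∀ d ∈ p.support, H d.degree ≤ monomialRank d := by
  rw [lexIdeal, MvPolynomial.mem_ideal_span_monomial_image]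
  refine forall₂_congr fun d _ => ⟨?_, fun h => ⟨d, h, le_rfl⟩⟩
  rintro ⟨m, hm, hmd⟩
  exact hH.le_monomialRank_mono hm hmd

theorem IsOSequence.monomial_mem_lexIdeal (hH : IsOSequence H) {d : Fin r →₀ ℕ}
    (hd : H d.degree ≤ monomialRank d) (a : k) :
    MvPolynomial.monomial d a ∈ lexIdeal k r H := by
  rw [hH.mem_lexIdeal_iff]
  intro d' hd'
  rw [Finset.mem_singleton.1 (MvPolynomial.support_monomial_subset hd')]
  exact hd

/-- Iterating Macaulay's bound from degree one shows that `H 1` variables supply enough monomials in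
every degree. -/
theorem IsOSequence.le_choose (hH : IsOSequence H) (i : ℕ) :
    H i ≤ (H 1 + i - 1).choose i := by
  induction i with
  | zero => simp [hH.zero]
  | succ i ih =>
    rcases Nat.eq_zero_or_pos i with rfl | hi
    · simp
    · refine (hH.growth i hi).trans ((upperShift_mono hi ih).trans ?_)
      simp only
      obtain ⟨i, rfl⟩ : ∃ j, i = j + 1 := ⟨i - 1, by omega⟩
      rcases Nat.eq_zero_or_pos (H 1) with h0 | h0
      · simp [h0]
      · rw [upperShift_choose (by omega),
          show H 1 + (i + 1) - 1 + 1 = H 1 + (i + 1 + 1) - 1 by omega]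

/-- The exponents of the standard monomials of degree `i`. -/
abbrev standardExponents (r : ℕ) (H : ℕ → ℕ) (i : ℕ) : Type :=
  {m : Fin r →₀ ℕ // m.degree = i ∧ monomialRank m < H i}

theorem IsOSequence.bijective_rank (hH : IsOSequence H) (i : ℕ) :
    Function.Bijective fun m : standardExponents (H 1) H i =>
      (⟨monomialRank m.1, m.2.2⟩ : Fin (H i)) := by
  constructor
  · rintro ⟨m, hm, _⟩ ⟨m', hm', _⟩ h
    exact Subtype.ext (monomialRank_inj (hm.trans hm'.symm) (Fin.mk.inj_iff.1 h))
  · rintro ⟨n, hn⟩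
    obtain ⟨m, h1, h2⟩ := exists_monomialRank_eq (r := H 1) (hn.trans_le (hH.le_choose i))
    exact ⟨⟨m, h1, h2 ▸ hn⟩, Fin.ext h2⟩

theorem IsOSequence.linearIndependent_standard (hH : IsOSequence H) (i : ℕ) :
    LinearIndependent k fun m : standardExponents r H i =>
      Ideal.Quotient.mk (lexIdeal k r H) (MvPolynomial.monomial m.1 1) := by
  rw [linearIndependent_iff']
  intro s g hg m hm
  by_contra hne
  have h1 : Ideal.Quotient.mk (lexIdeal k r H)
      (∑ m ∈ s, MvPolynomial.monomial m.1 (g m)) = 0 := by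
    rw [← hg, map_sum]
    refine Finset.sum_congr rfl fun m _ => ?_
    have : MvPolynomial.monomial m.1 (g m) = g m • MvPolynomial.monomial m.1 (1 : k) := by
      rw [MvPolynomial.smul_monomial, smul_eq_mul, mul_one]
    rw [this]
    exact map_smul (Ideal.Quotient.mkₐ k (lexIdeal k r H)) _ _
  rw [Ideal.Quotient.eq_zero_iff_mem, hH.mem_lexIdeal_iff] at h1
  have h2 : MvPolynomial.coeff m.1 (∑ m ∈ s, MvPolynomial.monomial m.1 (g m)) = g m := by
    rw [MvPolynomial.coeff_sum, Finset.sum_eq_single_of_mem m hm]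
    · simp
    · intro b _ hb
      rw [MvPolynomial.coeff_monomial, if_neg fun h => hb (Subtype.ext h)]
  have h3 := h1 m.1 (MvPolynomial.mem_support_iff.2 (by rw [h2]; exact hne))
  rw [m.2.1] at h3
  exact absurd m.2.2 (not_lt.2 h3)

theorem IsOSequence.gradedPiece_eq_span (hH : IsOSequence H) (i : ℕ) :
    gradedPiece (lexIdeal k r H) i = Submodule.span k (Set.range
      fun m : standardExponents r H i =>
        Ideal.Quotient.mk (lexIdeal k r H) (MvPolynomial.monomial m.1 1)) := by
  apply le_antisymm
  · rintro _ ⟨p, hp, rfl⟩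
    change Ideal.Quotient.mk _ p ∈ _
    rw [p.as_sum, map_sum]
    refine Submodule.sum_mem _ fun d hd => ?_
    have hdeg : d.degree = i := by
      by_contra hne
      exact MvPolynomial.mem_support_iff.1 hd (MvPolynomial.IsHomogeneous.coeff_eq_zero hp hne)
    rcases Nat.lt_or_ge (monomialRank d) (H i) with h | h
    · have : MvPolynomial.monomial d (p.coeff d) =
          p.coeff d • MvPolynomial.monomial d (1 : k) := by
        rw [MvPolynomial.smul_monomial, smul_eq_mul, mul_one]
      rw [this]
      change p.coeff d • Ideal.Quotient.mk (lexIdeal k r H) _ ∈ _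
      exact Submodule.smul_mem _ _ (Submodule.subset_span ⟨⟨d, hdeg, h⟩, rfl⟩)
    · rw [Ideal.Quotient.eq_zero_iff_mem.2 (hH.monomial_mem_lexIdeal (by rwa [hdeg]) _)]
      exact Submodule.zero_mem _
  · rw [Submodule.span_le]
    rintro _ ⟨m, rfl⟩
    exact ⟨_, MvPolynomial.isHomogeneous_monomial _ m.2.1, rfl⟩

theorem IsOSequence.hilbertFunction_lexIdeal (hH : IsOSequence H) (i : ℕ) :
    hilbertFunction (lexIdeal k (H 1) H) i = H i := by
  have hb := hH.bijective_rank i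
  have : Finite (standardExponents (H 1) H i) := Finite.of_injective _ hb.1
  have := Fintype.ofFinite (standardExponents (H 1) H i)
  rw [hilbertFunction, hH.gradedPiece_eq_span,
    finrank_span_eq_card (hH.linearIndependent_standard i), Fintype.card_of_bijective hb,
    Fintype.card_fin]

theorem IsOSequence.isArtinianRing_lexIdeal (hH : IsOSequence H) {e : ℕ}
    (he : ∀ i, e < i → H i = 0) : IsArtinianRing (MvPolynomial (Fin r) k ⧸ lexIdeal k r H) := by
  have htop : ⨆ i : Fin (e + 1), gradedPiece (lexIdeal k r H) i = ⊤ := by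
    rw [eq_top_iff]
    rintro x -
    obtain ⟨p, rfl⟩ := Ideal.Quotient.mk_surjective x
    rw [p.as_sum, map_sum]
    refine Submodule.sum_mem _ fun d _ => ?_
    rcases Nat.lt_or_ge e d.degree with h | h
    · rw [Ideal.Quotient.eq_zero_iff_mem.2 (hH.monomial_mem_lexIdeal (by simp [he _ h]) _)]
      exact Submodule.zero_mem _
    · exact Submodule.mem_iSup_of_mem ⟨d.degree, Nat.lt_succ_of_le h⟩
        ⟨_, MvPolynomial.isHomogeneous_monomial _ rfl, rfl⟩
  have : Module.Finite k (MvPolynomial (Fin r) k ⧸ lexIdeal k r H) := by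
    rw [Module.finite_def, ← htop]
    exact Submodule.fg_iSup _ fun i => Module.Finite.iff_fg.1 inferInstance
  exact IsArtinianRing.of_finite k _

/-! ### Failure of maximal rank for the lexicographic algebra -/

/-- In degree `i`, the algebra has a nonzero element annihilated by all linear forms. -/
theorem IsOSequence.not_injective_mulLinearForm (hH : IsOSequence H) {i : ℕ} (hi : 1 ≤ i)
    (h : lowerShift (H (i + 1)) (i + 1) < H i) (c : Fin (H 1) → k) :
    ¬ Function.Injective (mulLinearForm (lexIdeal k (H 1) H) c i) := by
  -- The largest standard monomial: strictness gives `H (i + 1) ≤ upperShift (H i - 1) i`, so all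
  -- its products with variables fall into the ideal.
  obtain ⟨m, hm, hrk⟩ := exists_monomialRank_eq (r := H 1) (n := H i - 1) (d := i)
    (by have := hH.le_choose i; omega)
  let x : gradedPiece (lexIdeal k (H 1) H) i :=
    ⟨Ideal.Quotient.mk _ (MvPolynomial.monomial m 1), _,
      MvPolynomial.isHomogeneous_monomial _ hm, rfl⟩
  intro hinj
  have hx : x = 0 := by
    apply hinj
    rw [map_zero]
    ext
    rw [mulLinearForm_apply]
    change _ * Ideal.Quotient.mk _ _ = 0
    rw [← map_mul, Ideal.Quotient.eq_zero_iff_mem, linearForm, Finset.sum_mul]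
    refine Ideal.sum_mem _ fun s _ => ?_
    rw [mul_assoc, mul_comm (MvPolynomial.X s), MvPolynomial.X, MvPolynomial.monomial_mul, one_mul]
    refine Ideal.mul_mem_left _ _ (hH.monomial_mem_lexIdeal ?_ _)
    have h1 : H (i + 1) ≤ upperShift (H i - 1) i := by
      rw [← lowerShift_le_iff hi]
      omega
    have h2 := upperShift_monomialRank_le m s
    rw [map_add, Finsupp.degree_single, hm]
    rw [hm, hrk] at h2
    exact h1.trans h2
  have hx' : MvPolynomial.monomial m (1 : k) ∈ lexIdeal k (H 1) H :=
    Ideal.Quotient.eq_zero_iff_mem.1 (congrArg Subtype.val hx)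
  rw [hH.mem_lexIdeal_iff] at hx'
  have h3 := hx' m (by simp [MvPolynomial.mem_support_iff])
  rw [hm, hrk] at h3
  omega

/-- The algebra maps onto a polynomial ring in two variables in degrees at most `i + 1`. -/
theorem IsOSequence.not_surjective_mulLinearForm (hH : IsOSequence H) {i n : ℕ}
    (h : i + 1 < H (i + 1)) (c : Fin (n + 2) → k) (hc : c 1 ≠ 0) :
    ¬ Function.Surjective (mulLinearForm (lexIdeal k (n + 2) H) c i) := by
  intro hsurj
  -- The zero of the linear form on the line where all variables but the first two vanish.
  -- Evaluation at `P` kills both `L A_i` and the ideal in degree `i + 1`, but not the power of `X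
  -- 0`, because `c 1 ≠ 0`.
  let P : Fin (n + 2) → k := Fin.cons (c 1) (Fin.cons (-c 0) 0)
  have hL : MvPolynomial.eval P (linearForm c) = 0 := by
    simp only [linearForm, map_sum, map_mul, MvPolynomial.eval_C, MvPolynomial.eval_X]
    rw [Fin.sum_univ_succ, Fin.sum_univ_succ]
    simp [P]
    ring
  have hI : ∀ f ∈ lexIdeal k (n + 2) H, f.IsHomogeneous (i + 1) → MvPolynomial.eval P f = 0 := by
    intro f hf hhom
    rw [hH.mem_lexIdeal_iff] at hf
    rw [MvPolynomial.eval_eq]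
    refine Finset.sum_eq_zero fun d hd => ?_
    have hdeg : d.degree = i + 1 := by
      by_contra hne
      exact MvPolynomial.mem_support_iff.1 hd (hhom.coeff_eq_zero hne)
    -- The `i + 2` monomials of degree `i + 1` in the first two variables have ranks below `i + 2 ≤
    -- H (i + 1)`, hence are standard.
    obtain ⟨s, hs, hs2⟩ : ∃ s ∈ d.support, 2 ≤ (s : ℕ) := by
      by_contra! h2
      have h3 := monomialRank_lt h2
      have h4 := hf d hd
      rw [hdeg] at h3 h4
      rw [show 2 + (i + 1) - 1 = i + 1 + 1 by omega, Nat.choose_succ_self_right] at h3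
      omega
    have hP : P s = 0 := by
      obtain ⟨s, rfl⟩ := Fin.exists_succ_eq.2 (show s ≠ 0 by rintro rfl; simp at hs2)
      obtain ⟨s, rfl⟩ := Fin.exists_succ_eq.2 (show s ≠ 0 by rintro rfl; simp at hs2)
      simp [P]
    rw [Finset.prod_eq_zero hs (by rw [hP, zero_pow (Finsupp.mem_support_iff.1 hs)]), mul_zero]
  let x : gradedPiece (lexIdeal k (n + 2) H) (i + 1) :=
    ⟨Ideal.Quotient.mk _ (MvPolynomial.X 0 ^ (i + 1)), _,
      MvPolynomial.isHomogeneous_X_pow _ _, rfl⟩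
  obtain ⟨⟨_, q, hq, rfl⟩, hy⟩ := hsurj x
  have h1 : Ideal.Quotient.mk (lexIdeal k (n + 2) H) (linearForm c * q) =
    Ideal.Quotient.mk (lexIdeal k (n + 2) H) (MvPolynomial.X 0 ^ (i + 1)) :=
    congrArg Subtype.val hy
  rw [Ideal.Quotient.eq] at h1
  have h2 := (linearForm_isHomogeneous c).mul hq
  rw [add_comm 1 i] at h2
  have h3 := hI _ h1 (h2.sub (MvPolynomial.isHomogeneous_X_pow _ _))
  simp only [map_sub, map_mul, hL, zero_mul, map_pow, MvPolynomial.eval_X, zero_sub,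
    neg_eq_zero] at h3
  exact pow_ne_zero _ hc h3

theorem IsOSequence.not_hasWLP_lexIdeal [Infinite k] (hH : IsOSequence H) {i : ℕ} (hi : 1 ≤ i)
    (h : lowerShift (H (i + 1)) (i + 1) < H i) (h' : i + 1 < H (i + 1)) :
    ¬ HasWLP (lexIdeal k (H 1) H) := by
  rintro ⟨F, hF, hwlp⟩
  obtain ⟨n, hn⟩ : ∃ n, H 1 = n + 2 := by
    refine ⟨H 1 - 2, ?_⟩
    by_contra hlt
    have h1 := hH.le_choose (i + 1)
    have h2 := Nat.choose_le_choose (i + 1) (show H 1 + (i + 1) - 1 ≤ i + 1 by omega)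
    rw [Nat.choose_self] at h2
    omega
  obtain ⟨c, hc⟩ := exists_eval_ne_zero (mul_ne_zero hF
    (MvPolynomial.X_ne_zero (R := k) (Fin.cast hn.symm 1)))
  rw [map_mul, mul_ne_zero_iff, MvPolynomial.eval_X] at hc
  have hrk := hwlp c hc.1 i
  have hni := hH.not_injective_mulLinearForm hi h c
  have hns : ¬ Function.Surjective (mulLinearForm (lexIdeal k (H 1) H) c i) := by
    -- The number of variables is made independent of `H`, so that `n + 2` can be substituted for
    -- it.
    have key : ∀ (r : ℕ) (hr : r = n + 2) (c : Fin r → k), c (Fin.cast hr.symm 1) ≠ 0 →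
        ¬ Function.Surjective (mulLinearForm (lexIdeal k r H) c i) := by
      rintro _ rfl c hc
      exact hH.not_surjective_mulLinearForm h' c hc
    exact key _ hn c hc.2
  rcases min_choice (hilbertFunction (lexIdeal k (H 1) H) i)
    (hilbertFunction (lexIdeal k (H 1) H) (i + 1)) with hmin | hmin
  · apply hni
    rw [← LinearMap.ker_eq_bot]
    have := LinearMap.finrank_range_add_finrank_ker (mulLinearForm (lexIdeal k (H 1) H) c i)
    rw [hrk, hmin, hilbertFunction] at this
    exact Submodule.finrank_eq_zero.1 (by omega)
  · apply hns
    rw [← LinearMap.range_eq_top]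
    exact Submodule.eq_top_of_finrank_eq (hrk.trans hmin)

end LexIdeal

end WeakLefschetz

/-! ### The characterization -/

theorem theorem5 {k : Type*} [Field k] [CharZero k] (H : ℕ → ℕ) (hH : WeakLefschetz.IsOSequence H)
    (e : ℕ) (he : ∀ i, e < i → H i = 0) (t : ℕ) (ht : IsLeast {s : ℕ | H s ≤ s} t) :
    (∀ (r : ℕ) (I : Ideal (MvPolynomial (Fin r) k)),
        I.IsHomogeneous (MvPolynomial.homogeneousSubmodule (Fin r) k) →
        IsArtinianRing (MvPolynomial (Fin r) k ⧸ I) →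
        (∀ i, WeakLefschetz.hilbertFunction I i = H i) →
        WeakLefschetz.HasWLP I) ↔
      ∀ i : ℕ, 1 ≤ i → i < t → H (i - 1) = WeakLefschetz.lowerShift (H i) i := by
  have hinf : Infinite k := CharZero.infinite k
  constructor
  · intro hall i hi hit
    obtain ⟨i, rfl⟩ : ∃ j, i = j + 1 := ⟨i - 1, by omega⟩
    have hlt : i + 1 < H (i + 1) := not_le.1 fun h => absurd (ht.2 h) (not_le.2 hit)
    rw [Nat.add_sub_cancel]
    -- Between degrees 0 and 1 equality is automatic, both sides being 1; Macaulay's inequality only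
    -- starts at `i = 1`.
    rcases Nat.eq_zero_or_pos i with rfl | hi0
    · rw [hH.zero, WeakLefschetz.lowerShift_one (by omega)]
    · by_contra hne
      have hle := (WeakLefschetz.lowerShift_le_iff hi0).2 (hH.growth i hi0)
      exact hH.not_hasWLP_lexIdeal hi0 (lt_of_le_of_ne hle (Ne.symm hne)) hlt
        (hall _ _ WeakLefschetz.lexIdeal_isHomogeneous (hH.isArtinianRing_lexIdeal he)
          hH.hilbertFunction_lexIdeal)
  · intro h r I _ _ hI
    have ht1 : H t ≤ t := ht.1
    have ht0 : 1 ≤ t := by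
      by_contra h0
      obtain rfl : t = 0 := by omega
      rw [hH.zero] at ht1
      omega
    refine WeakLefschetz.hasWLP_of_eq_lowerShift I (by rw [hI]; exact ht1) ht0 ?_
    intro i hi hit
    rw [hI, hI]
    exact h i hi hit
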